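/- Let $R$ be a finite associative ring with identity, of order $|R| = 2^a m$ with $m$ odd, whose group of units $R^*$ is a minimal non-nilpotent group, i.e. $R^*$ is not nilpotent but every proper subgroup of $R^*$ is nilpotent. Then $|R| = 2^a$. If, moreover, $(R/\mathrm{Jac}(R))^*$ is not a $p$-group for any prime $p$, where $\mathrm{Jac}(R)$ denotes the Jacobson radical of $R$, then, as rings, either $R \cong M_2(GF(2))$ or $R \cong M_2(GF(2)) \oplus A$, where $A$ is a direct sum of finitely many (at least one) copies of the field $GF(2)$ of two elements. -/

import Mathlib

/-- A group is minimal non-nilpotent if it is not nilpotent but all of its proper subgroups are. -/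
def IsMinimalNonNilpotent (G : Type*) [Group G] : Prop :=
  ¬ Group.IsNilpotent G ∧ ∀ H : Subgroup G, H ≠ ⊤ → Group.IsNilpotent H

/-! ### Nilpotency criteria for finite groups -/

section GroupTheory

variable {G : Type*} [Group G]

/-! A nontrivial element of odd order together with an element inverting it rules out nilpotency. By
minimality, a subgroup of `Rˣ` containing such a pair is all of `Rˣ`. Applied to `leftFixingUnits
c`, this says that every unit fixes `c`, a strong ring identity.

Odd part: a central idempotent splits `Rˣ` as a product, so minimality puts all of `Rˣ` on one side;
since `-1` acts nontrivially on the odd component, only that side can survive, and a ring of odd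
characteristic remains. There idempotents are central, so the ring is local with residue field
`R/J`. The lifting lemma `Group.isNilpotent_of_surjective_of_not_isPGroup` makes `(R/J)ˣ` a 2-group.
The preimage of its squares is proper, hence nilpotent, so squares lift to elements centralizing `1
+ J`. As `4r = (r+1)² - (r-1)²`, every element does, and `Rˣ` is nilpotent, a contradiction.

Even part: if `(R/J)ˣ` is not a `p`-group, it is not nilpotent, so a Wedderburn block of size at
least 2 exists. Two transvections in it generate a copy of `S₃`, which must be all of `(R/J)ˣ`.
Counting units leaves one block `M₂(GF(2))` and copies of `GF(2)`. Finally
`jacobson_eq_bot_of_conj_eq_inv` lifts the inverted element of order 3 and forces `J = 0`. -/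

theorem Group.IsNilpotent.commute_of_coprime_orderOf [Finite G] [Group.IsNilpotent G] {x y : G}
    (h : (orderOf x).Coprime (orderOf y)) : Commute x y := by
  -- A finite nilpotent group is the product of its Sylow subgroups; in each factor one of the two
  -- components is trivial.
  obtain ⟨φ⟩ := (Group.isNilpotent_of_finite_tfae (G := G)).out 0 4 |>.mp ‹_›
  have key : Commute (φ.symm x) (φ.symm y) := by
    funext p P
    have hp : Fact (p : ℕ).Prime := ⟨Nat.prime_of_mem_primeFactors p.2⟩
    have hd : ∀ z : G, orderOf (φ.symm z p P) ∣ orderOf z := fun z ↦ by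
      refine orderOf_dvd_of_pow_eq_one ?_
      rw [← Pi.pow_apply, ← Pi.pow_apply, ← map_pow, pow_orderOf_eq_one, map_one]
      rfl
    obtain ⟨k, hk⟩ := IsPGroup.iff_orderOf.mp P.2 (φ.symm x p P)
    obtain ⟨l, hl⟩ := IsPGroup.iff_orderOf.mp P.2 (φ.symm y p P)
    have hc := Nat.Coprime.coprime_dvd_left (hd x) (Nat.Coprime.coprime_dvd_right (hd y) h)
    rw [hk, hl] at hc
    simp only [Pi.mul_apply]
    rcases Nat.eq_zero_or_pos k with rfl | hk0
    · rw [pow_zero, orderOf_eq_one_iff] at hk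
      rw [hk, one_mul, mul_one]
    rcases Nat.eq_zero_or_pos l with rfl | hl0
    · rw [pow_zero, orderOf_eq_one_iff] at hl
      rw [hl, one_mul, mul_one]
    · rw [Nat.coprime_pow_left_iff hk0, Nat.coprime_pow_right_iff hl0, Nat.coprime_self] at hc
      exact absurd hc hp.out.one_lt.ne'
  simpa using key.map φ.toMonoidHom

theorem Group.isNilpotent_of_commuting_subgroups (A B : Subgroup G)
    [Group.IsNilpotent A] [Group.IsNilpotent B]
    (hcomm : ∀ a ∈ A, ∀ b ∈ B, Commute a b) (hmul : ∀ g : G, ∃ a ∈ A, ∃ b ∈ B, g = a * b) :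
    Group.IsNilpotent G := by
  refine Group.nilpotent_of_surjective
    (MonoidHom.noncommCoprod A.subtype B.subtype fun a b ↦ hcomm a a.2 b b.2) fun g ↦ ?_
  obtain ⟨a, ha, b, hb, rfl⟩ := hmul g
  exact ⟨(⟨a, ha⟩, ⟨b, hb⟩), rfl⟩

open scoped commutatorElement in
-- Since `⁅u, t⁆ = u²`, iterated commutators with `t` give `u ^ 2 ^ j`, which never becomes trivial
-- because `u` has odd order.
theorem Group.not_isNilpotent_of_conj_eq_inv {u t : G} (hu : u ≠ 1) {n : ℕ} (hn : Odd n)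
    (hun : u ^ n = 1) (htu : t * u * t⁻¹ = u⁻¹) : ¬ Group.IsNilpotent G := by
  intro hnil
  obtain ⟨k, hk⟩ := Subgroup.nilpotent_iff_lowerCentralSeries.mp hnil
  have key : ∀ j, u ^ 2 ^ j ∈ (⊤ : Subgroup G).lowerCentralSeries j := by
    intro j
    induction j with
    | zero => simp
    | succ j ih =>
      have h1 : t * u ^ 2 ^ j * t⁻¹ = (u ^ 2 ^ j)⁻¹ := by
        rw [← conj_pow, htu, inv_pow]
      have h2 : ⁅u ^ 2 ^ j, t⁆ = u ^ 2 ^ (j + 1) := by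
        have h3 : t * (u ^ 2 ^ j)⁻¹ * t⁻¹ = u ^ 2 ^ j := by
          rw [← conj_inv, h1, inv_inv]
        rw [commutatorElement_def, mul_assoc, mul_assoc, ← mul_assoc t, h3, ← pow_add, pow_succ,
          mul_two]
      rw [Subgroup.lowerCentralSeries_succ, ← h2]
      exact Subgroup.commutator_mem_commutator ih (Subgroup.mem_top t)
  have h := key k
  rw [hk, Subgroup.mem_bot] at h
  have hc : n.Coprime (2 ^ k) := (Nat.coprime_two_right.mpr hn).pow_right k
  have := pow_gcd_eq_one.mpr ⟨hun, h⟩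
  rw [hc, pow_one] at this
  exact hu this

theorem Subgroup.not_isNilpotent_of_conj_eq_inv {H : Subgroup G} {u t : G} (huH : u ∈ H)
    (htH : t ∈ H) (hu : u ≠ 1) {n : ℕ} (hn : Odd n)
    (hun : u ^ n = 1) (htu : t * u * t⁻¹ = u⁻¹) : ¬ Group.IsNilpotent H :=
  Group.not_isNilpotent_of_conj_eq_inv (u := (⟨u, huH⟩ : H)) (t := ⟨t, htH⟩)
    (by simpa [Subtype.ext_iff] using hu) hn (by simpa [Subtype.ext_iff] using hun)
    (by simpa [Subtype.ext_iff] using htu)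

/-- The image of a Sylow subgroup `S` is normal in `Q` and proper, as `Q` is not a `p`-group. Its
preimage `K` is then normal and nilpotent, so `S` is characteristic in `K` and normal in `G`. -/
theorem Group.isNilpotent_of_surjective_of_not_isPGroup [Finite G] {Q : Type*} [Group Q]
    (φ : G →* Q) (hφ : Function.Surjective φ) [Group.IsNilpotent Q]
    (hQ : ∀ p : ℕ, p.Prime → ¬ IsPGroup p Q)
    (hG : ∀ H : Subgroup G, H ≠ ⊤ → Group.IsNilpotent H) : Group.IsNilpotent G := by
  have : Finite Q := Finite.of_surjective φ hφ
  refine (Group.isNilpotent_of_finite_tfae (G := G)).out 0 3 |>.mpr ?_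
  intro p hp S
  have hSQ : (S.mapSurjective hφ : Subgroup Q).Normal := inferInstance
  set K : Subgroup G := (S.mapSurjective hφ : Subgroup Q).comap φ with hK
  have hKn : K.Normal := hSQ.comap φ
  have hKtop : K ≠ ⊤ := by
    intro h
    have h1 : (S.mapSurjective hφ : Subgroup Q) = ⊤ := by
      rw [eq_top_iff]
      intro q _
      obtain ⟨g, rfl⟩ := hφ q
      have : g ∈ K := h ▸ Subgroup.mem_top g
      exact this
    refine hQ p hp.out ?_
    have h2 := (S.mapSurjective hφ).2
    change IsPGroup p (S.mapSurjective hφ : Subgroup Q) at h2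
    rw [h1] at h2
    exact h2.of_equiv Subgroup.topEquiv
  have hKnil := hG K hKtop
  have hle : (S : Subgroup G) ≤ K := by
    rw [hK, ← Subgroup.map_le_iff_le_comap]
    exact le_of_eq (Sylow.coe_mapSurjective hφ S).symm
  have hSK : (S.subtype hle : Subgroup K).Normal := inferInstance
  have hchar : (S.subtype hle : Subgroup K).Characteristic :=
    Sylow.characteristic_of_normal _ hSK
  have h3 : ((S.subtype hle : Subgroup K).map K.subtype).Normal := inferInstance
  have h4 : (S.subtype hle : Subgroup K).map K.subtype = S := by
    rw [Sylow.coe_subtype, Subgroup.subgroupOf_map_subtype, inf_eq_left.mpr hle]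
  rwa [h4] at h3

theorem Subgroup.isNilpotent_of_comap {Q : Type*} [Group Q] (φ : G →* Q)
    (hφ : Function.Surjective φ) (H : Subgroup Q) (h : Group.IsNilpotent (H.comap φ)) :
    Group.IsNilpotent H := by
  refine Group.nilpotent_of_surjective (φ.subgroupComap H) ?_
  exact MonoidHom.subgroupComap_surjective_of_surjective φ H hφ

theorem IsMinimalNonNilpotent.eq_top_of_not_isNilpotent (hG : IsMinimalNonNilpotent G)
    {H : Subgroup G} (hH : ¬ Group.IsNilpotent H) : H = ⊤ := by
  by_contra h
  exact hH (hG.2 H h)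

theorem IsMinimalNonNilpotent.of_mulEquiv {G' : Type*} [Group G'] (e : G ≃* G')
    (hG : IsMinimalNonNilpotent G) : IsMinimalNonNilpotent G' := by
  refine ⟨fun h ↦ hG.1 ((Group.isNilpotent_congr e).mpr h), fun H hH ↦ ?_⟩
  have h1 : H.comap e.toMonoidHom ≠ ⊤ := by
    intro h
    apply hH
    rw [eq_top_iff]
    intro x _
    have : e.symm x ∈ H.comap e.toMonoidHom := h ▸ Subgroup.mem_top _
    simpa using this
  exact Subgroup.isNilpotent_of_comap _ e.surjective H (hG.2 _ h1)

end GroupTheory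

/-! ### Units modulo the Jacobson radical -/

section JacobsonUnits

variable {R : Type*} [Ring R]

instance finite_quotient_ideal [Finite R] (I : Ideal R) : Finite (R ⧸ I) :=
  Finite.of_surjective _ (Submodule.Quotient.mk_surjective I)

theorem mul_eq_one_symm_of_finite [Finite R] {a b : R} (h : a * b = 1) : b * a = 1 :=
  mul_eq_one_comm.mp h

theorem isUnit_one_add_of_mem_jacobson [Finite R] {x : R} (hx : x ∈ Ring.jacobson R) :
    IsUnit (1 + x) := by
  rw [← Ideal.jacobson_bot, Ideal.mem_jacobson_iff] at hx
  obtain ⟨z, hz⟩ := hx 1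
  have h1 : z * (1 + x) = 1 := by
    rw [Ideal.mem_bot] at hz
    rw [← sub_eq_zero, ← hz]
    noncomm_ring
  exact ⟨⟨1 + x, z, mul_eq_one_symm_of_finite h1, h1⟩, rfl⟩

theorem mem_jacobson_of_forall_isUnit {x : R} (h : ∀ y, IsUnit (1 + y * x)) :
    x ∈ Ring.jacobson R := by
  rw [← Ideal.jacobson_bot, Ideal.mem_jacobson_iff]
  intro y
  obtain ⟨u, hu⟩ := h y
  refine ⟨(u⁻¹ : Rˣ), ?_⟩
  rw [Ideal.mem_bot, mul_assoc, ← mul_add_one, add_comm, ← hu, Units.inv_mul, sub_self]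

theorem isUnit_of_isUnit_mk_jacobson [Finite R] {r : R}
    (h : IsUnit (Ideal.Quotient.mk (Ring.jacobson R) r)) : IsUnit r := by
  obtain ⟨u, hu⟩ := h
  obtain ⟨s, hs⟩ := Ideal.Quotient.mk_surjective (u⁻¹ : (R ⧸ Ring.jacobson R)ˣ).val
  have h1 : r * s - 1 ∈ Ring.jacobson R := by
    rw [← Ideal.Quotient.eq_zero_iff_mem, map_sub, map_mul, hs, ← hu]
    simp
  obtain ⟨v, hv⟩ := isUnit_one_add_of_mem_jacobson h1
  have h2 : r * (s * (v⁻¹ : Rˣ)) = 1 := by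
    rw [← mul_assoc, Units.mul_inv_eq_iff_eq_mul, hv]
    noncomm_ring
  exact ⟨⟨r, _, h2, mul_eq_one_symm_of_finite h2⟩, rfl⟩

variable (R) in
/-- The reduction of units modulo the Jacobson radical. -/
def unitsModJacobson : Rˣ →* (R ⧸ Ring.jacobson R)ˣ :=
  Units.map (Ideal.Quotient.mk (Ring.jacobson R) : R →* R ⧸ Ring.jacobson R)

@[simp]
theorem coe_unitsModJacobson (g : Rˣ) :
    (unitsModJacobson R g : R ⧸ Ring.jacobson R) = Ideal.Quotient.mk _ (g : R) := rfl

theorem unitsModJacobson_surjective [Finite R] : Function.Surjective (unitsModJacobson R) := by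
  intro u
  obtain ⟨r, hr⟩ := Ideal.Quotient.mk_surjective u.val
  obtain ⟨g, rfl⟩ := isUnit_of_isUnit_mk_jacobson (r := r) (hr ▸ u.isUnit)
  exact ⟨g, Units.ext hr⟩

theorem unitsModJacobson_eq_iff {g h : Rˣ} :
    unitsModJacobson R g = unitsModJacobson R h ↔ (g : R) - h ∈ Ring.jacobson R := by
  rw [Units.ext_iff, coe_unitsModJacobson, coe_unitsModJacobson, Ideal.Quotient.eq]

theorem mem_ker_unitsModJacobson {g : Rˣ} :
    g ∈ (unitsModJacobson R).ker ↔ (g : R) - 1 ∈ Ring.jacobson R := by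
  rw [MonoidHom.mem_ker, ← map_one (unitsModJacobson R), unitsModJacobson_eq_iff, Units.val_one]

theorem card_ker_unitsModJacobson [Finite R] :
    Nat.card (unitsModJacobson R).ker = Nat.card (Ring.jacobson R) := by
  refine Nat.card_eq_of_bijective
    (fun g ↦ ⟨(g : Rˣ) - 1, mem_ker_unitsModJacobson.mp g.2⟩) ⟨fun g h hgh ↦ ?_, fun x ↦ ?_⟩
  · exact Subtype.ext (Units.ext (sub_left_injective (congrArg Subtype.val hgh)))
  · obtain ⟨u, hu⟩ := isUnit_one_add_of_mem_jacobson x.2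
    exact ⟨⟨u, mem_ker_unitsModJacobson.mpr (by simp [hu])⟩, by simp [hu]⟩

theorem commute_coe_of_commute_ker_unitsModJacobson [Finite R] {g : Rˣ}
    (h : ∀ p ∈ (unitsModJacobson R).ker, Commute g p) {y : R} (hy : y ∈ Ring.jacobson R) :
    (g : R) * y = y * g := by
  obtain ⟨u, hu⟩ := isUnit_one_add_of_mem_jacobson hy
  have h1 := congrArg Units.val (h u (mem_ker_unitsModJacobson.mpr (by simpa [hu]))).eq
  simpa [hu, mul_add, add_mul] using h1

theorem card_jacobson_dvd [Finite R] : Nat.card (Ring.jacobson R) ∣ Nat.card R :=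
  AddSubgroup.card_addSubgroup_dvd_card (Ring.jacobson R).toAddSubgroup

end JacobsonUnits

/-! ### Idempotents and units in odd characteristic -/

section OddCharacteristic

variable {R : Type*} [Ring R]

theorem eq_zero_of_two_mul_eq_zero {n : ℕ} (hn : Odd n) (hnR : (n : R) = 0) {x : R}
    (hx : 2 * x = 0) : x = 0 := by
  obtain ⟨k, rfl⟩ := hn
  have h : x = ((2 * k + 1 : ℕ) : R) * x - k * (2 * x) := by
    push_cast
    rw [← mul_assoc, (Nat.cast_commute k (2 : R)).eq]
    noncomm_ring
  rw [h, hnR, hx, zero_mul, mul_zero, sub_zero]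

theorem odd_card_jacobson [Finite R] {n : ℕ} (hn : Odd n) (hnR : (n : R) = 0) :
    Odd (Nat.card (Ring.jacobson R)) := by
  rw [← Nat.not_even_iff_odd, even_iff_two_dvd]
  intro h
  have : Fact (Nat.Prime 2) := ⟨Nat.prime_two⟩
  obtain ⟨x, hx⟩ := exists_prime_addOrderOf_dvd_card' (G := Ring.jacobson R) 2 h
  have h1 : 2 • x = 0 := hx ▸ addOrderOf_nsmul_eq_zero x
  have h2 : x = 0 := by
    ext
    refine eq_zero_of_two_mul_eq_zero hn hnR ?_
    simpa [Subtype.ext_iff, two_nsmul, two_mul] using h1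
  rw [h2, addOrderOf_zero] at hx
  exact absurd hx (by norm_num)

theorem one_sub_two_mul_mul_self {e : R} (he : e * e = e) : (1 - 2 * e) * (1 - 2 * e) = 1 := by
  calc (1 - 2 * e) * (1 - 2 * e) = 1 - 4 * e + 4 * (e * e) := by noncomm_ring
    _ = 1 := by rw [he]; noncomm_ring

/-- The unit `1 - 2e` attached to an idempotent `e`. -/
def reflectionUnit (e : R) (he : e * e = e) : Rˣ where
  val := 1 - 2 * e
  inv := 1 - 2 * e
  val_inv := one_sub_two_mul_mul_self he
  inv_val := one_sub_two_mul_mul_self he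

/-- The unit `1 + x` attached to an element `x` of square zero. -/
def transvectionUnit (x : R) (hx : x * x = 0) : Rˣ where
  val := 1 + x
  inv := 1 - x
  val_inv := by
    calc (1 + x) * (1 - x) = 1 - x * x := by noncomm_ring
      _ = 1 := by rw [hx, sub_zero]
  inv_val := by
    calc (1 - x) * (1 + x) = 1 - x * x := by noncomm_ring
      _ = 1 := by rw [hx, sub_zero]

theorem transvectionUnit_pow (x : R) (hx : x * x = 0) (n : ℕ) :
    ((transvectionUnit x hx ^ n : Rˣ) : R) = 1 + n * x := by
  induction n with
  | zero => simp
  | succ n ih =>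
    rw [pow_succ, Units.val_mul, ih]
    change (1 + n * x) * (1 + x) = _
    calc (1 + n * x) * (1 + x) = 1 + n * x + x + n * (x * x) := by noncomm_ring
      _ = _ := by rw [hx]; push_cast; noncomm_ring

/-- The subgroup of units `g` with `c * g = c`. -/
def leftFixingUnits (c : R) : Subgroup Rˣ where
  carrier := {g | c * g = c}
  mul_mem' {g h} hg hh := by
    change c * (g * h : Rˣ) = c
    rw [Units.val_mul, ← mul_assoc, show c * g = c from hg, show c * h = c from hh]
  one_mem' := by simp
  inv_mem' {g} hg := by
    change c * (g⁻¹ : Rˣ) = c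
    rw [Units.mul_inv_eq_iff_eq_mul, show c * g = c from hg]

theorem mem_leftFixingUnits {c : R} {g : Rˣ} : g ∈ leftFixingUnits c ↔ c * g = c := Iff.rfl

/-- If `x = e r (1 - e)` were nonzero, the transvection `1 + x`, of odd order, would be inverted by
the reflection `1 - 2e`. Both fix `1 - e`, so all units would, including `-1`; then `1 - e = 0` and
`x = 0`. -/
theorem IsMinimalNonNilpotent.idempotent_mul_mul_eq_zero
    (hR : IsMinimalNonNilpotent Rˣ) {n : ℕ} (hn : Odd n) (hnR : (n : R) = 0) {e : R}
    (he : e * e = e) (r : R) : e * r * (1 - e) = 0 := by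
  by_contra hx0
  set x := e * r * (1 - e) with hx
  have hxe : x * e = 0 := by
    rw [hx, mul_assoc, sub_mul, one_mul, he, sub_self, mul_zero]
  have hex : e * x = x := by
    rw [hx, ← mul_assoc, ← mul_assoc, he]
  have hxx : x * x = 0 := by
    nth_rewrite 2 [← hex]
    rw [← mul_assoc, hxe, zero_mul]
  have hmem1 : transvectionUnit x hxx ∈ leftFixingUnits (1 - e) := by
    rw [mem_leftFixingUnits]
    change (1 - e) * (1 + x) = 1 - e
    rw [mul_add, sub_mul, sub_mul, hex]
    simp
  have hmem2 : reflectionUnit e he ∈ leftFixingUnits (1 - e) := by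
    rw [mem_leftFixingUnits]
    change (1 - e) * (1 - 2 * e) = 1 - e
    calc (1 - e) * (1 - 2 * e) = 1 - e - 2 * e + 2 * (e * e) := by noncomm_ring
      _ = 1 - e := by rw [he]; noncomm_ring
  have htop := hR.eq_top_of_not_isNilpotent
    (Subgroup.not_isNilpotent_of_conj_eq_inv hmem1 hmem2 ?_ hn ?_ ?_)
  · have h1 : (-1 : Rˣ) ∈ leftFixingUnits (1 - e) := htop ▸ Subgroup.mem_top _
    rw [mem_leftFixingUnits] at h1
    have h2 : (1 - e) = 0 := by
      refine eq_zero_of_two_mul_eq_zero hn hnR ?_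
      rw [Units.val_neg, Units.val_one, mul_neg, mul_one] at h1
      rw [two_mul]
      nth_rewrite 1 [← h1]
      simp
    exact hx0 (by rw [h2, mul_zero] at hx; exact hx)
  · intro h
    have h1 : (1 : R) + x = 1 := congrArg Units.val h
    exact hx0 (by simpa using h1)
  · ext
    rw [transvectionUnit_pow, hnR]
    simp
  · ext
    change (1 - 2 * e) * (1 + x) * (1 - 2 * e) = 1 - x
    calc (1 - 2 * e) * (1 + x) * (1 - 2 * e)
        = 1 - 4 * e + 4 * (e * e) + x - 2 * (e * x) - 2 * (x * e) + 4 * ((e * x) * e) := by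
          noncomm_ring
      _ = 1 - x := by rw [he, hex, hxe]; noncomm_ring

theorem IsMinimalNonNilpotent.commute_idempotent
    (hR : IsMinimalNonNilpotent Rˣ) {n : ℕ} (hn : Odd n) (hnR : (n : R) = 0) {e : R}
    (he : e * e = e) (r : R) : Commute e r := by
  have h1 := hR.idempotent_mul_mul_eq_zero hn hnR he r
  have h2 := hR.idempotent_mul_mul_eq_zero hn hnR (e := 1 - e)
    (by calc (1 - e) * (1 - e) = 1 - 2 * e + e * e := by noncomm_ring
          _ = 1 - e := by rw [he]; noncomm_ring) r
  calc e * r = e * r * (1 - e) + e * r * e := by noncomm_ring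
    _ = e * r * e + (1 - e) * r * (1 - (1 - e)) := by rw [h1, h2]; simp
    _ = r * e := by noncomm_ring

theorem mul_add_one_sub_mul_eq_one {f g h : R} (hf : f * f = f) (hc : Commute f g)
    (hgh : g * h = 1) : (f * g + (1 - f)) * (f * h + (1 - f)) = 1 := by
  have hff : (1 - f) * f = 0 := by rw [sub_mul, hf, one_mul, sub_self]
  calc (f * g + (1 - f)) * (f * h + (1 - f))
      = f * (g * f) * h + f * (g - g * f) + (1 - f) * f * h + (1 - f) - (1 - f) * f := by
        noncomm_ring
    _ = f * f * (g * h) + (f - f * f) * g + (1 - f) * f * h + (1 - f) - (1 - f) * f := by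
        rw [← hc.eq]; noncomm_ring
    _ = 1 := by rw [hff, hf, hgh]; simp

/-- The unit acting as `g` on the range of the idempotent `f` and trivially on its complement. -/
def cornerUnit (f : R) (hf : f * f = f) (g : Rˣ) (hc : Commute f g) : Rˣ where
  val := f * g + (1 - f)
  inv := f * (g⁻¹ : Rˣ) + (1 - f)
  val_inv := mul_add_one_sub_mul_eq_one hf hc g.mul_inv
  inv_val := mul_add_one_sub_mul_eq_one hf hc.units_inv_right g.inv_mul

/-- The Peirce decomposition writes `Rˣ` as the product of two commuting subgroups, each acting
trivially on one component. -/
theorem isNilpotent_units_of_central_idempotent {e : R} (he : e * e = e)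
    (hc : ∀ r, Commute e r) [Group.IsNilpotent (leftFixingUnits e)]
    [Group.IsNilpotent (leftFixingUnits (1 - e))] : Group.IsNilpotent Rˣ := by
  refine Group.isNilpotent_of_commuting_subgroups (leftFixingUnits e) (leftFixingUnits (1 - e))
    (fun a ha b hb ↦ ?_) fun g ↦ ?_
  · rw [mem_leftFixingUnits] at ha hb
    have hb' : (b : R) = 1 - e + e * b := by
      rw [← hb]; noncomm_ring
    have hae := (hc a).eq
    have hbe := (hc b).eq
    refine Units.ext ?_
    rw [Units.val_mul, Units.val_mul]
    have h1 : (a : R) * b = a - e + e * b := by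
      calc (a : R) * b = a * (1 - e + e * b) := by rw [← hb']
        _ = a - a * e + a * e * b := by noncomm_ring
        _ = _ := by rw [← hae, ha]
    have h2 : (b : R) * a = a - e + e * b := by
      calc (b : R) * a = (1 - e + b * e) * a := by rw [← hbe, ← hb']
        _ = a - e * a + b * (e * a) := by noncomm_ring
        _ = _ := by rw [ha, ← hbe]
    rw [h1, h2]
  · have hee : e * (1 - e) = 0 := by rw [mul_sub, he, mul_one, sub_self]
    have hee' : (1 - e) * e = 0 := by rw [sub_mul, he, one_mul, sub_self]
    have hf2 : (1 - e) * (1 - e) = 1 - e := by rw [mul_sub, hee', mul_one, sub_zero]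
    have hfc2 : ∀ r, Commute (1 - e) r := fun r ↦ (Commute.one_left r).sub_left (hc r)
    refine ⟨cornerUnit (1 - e) hf2 g (hfc2 g), ?_, cornerUnit e he g (hc g), ?_, ?_⟩
    · rw [mem_leftFixingUnits]
      change e * ((1 - e) * g + (1 - (1 - e))) = e
      rw [mul_add, ← mul_assoc, hee, sub_sub_cancel, he, zero_mul, zero_add]
    · rw [mem_leftFixingUnits]
      change (1 - e) * (e * g + (1 - e)) = 1 - e
      rw [mul_add, ← mul_assoc, hee', hf2, zero_mul, zero_add]
    · refine Units.ext ?_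
      change (g : R) = ((1 - e) * g + (1 - (1 - e))) * (e * g + (1 - e))
      rw [sub_sub_cancel, (hc g).eq]
      calc (g : R) = (1 - e) * g * (1 - e) + g * e := by
            rw [mul_assoc, ← (hfc2 g).eq, ← mul_assoc, hf2, ← (hc g).eq]; noncomm_ring
        _ = (1 - e) * (g * g) * e + (1 - e) * g * (1 - e) + e * (g * e) + e * (1 - e) := by
            rw [← (hc g).eq, ← mul_assoc e, he, hee, mul_assoc (1 - e) (g * g : R) e,
              ← (hc (g * g)).eq, ← mul_assoc (1 - e) e, hee']
            noncomm_ring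
        _ = _ := by noncomm_ring

end OddCharacteristic

/-! ### Locality in odd characteristic and removal of the odd part -/

section OddCharacteristic

variable {R : Type*} [Ring R]

theorem exists_pow_isIdempotentElem_of_finite {M : Type*} [Monoid M] [Finite M] (x : M) :
    ∃ k : ℕ, 0 < k ∧ x ^ k * x ^ k = x ^ k := by
  obtain ⟨i, j, hij, hx⟩ : ∃ i j : ℕ, i < j ∧ x ^ i = x ^ j := by
    obtain ⟨i, j, hne, h⟩ := Finite.exists_ne_map_eq_of_infinite fun n : ℕ ↦ x ^ n
    rcases hne.lt_or_gt with h1 | h1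
    · exact ⟨i, j, h1, h⟩
    · exact ⟨j, i, h1, h.symm⟩
  obtain ⟨d, rfl⟩ := Nat.exists_eq_add_of_lt hij
  have hper : ∀ b m : ℕ, x ^ (i + b + m * (d + 1)) = x ^ (i + b) := by
    intro b m
    induction m with
    | zero => simp
    | succ m ih =>
      calc x ^ (i + b + (m + 1) * (d + 1)) = x ^ (i + d + 1) * x ^ (b + m * (d + 1)) := by
            rw [← pow_add]; congr 1; ring
        _ = x ^ (i + b + m * (d + 1)) := by rw [← hx, ← pow_add]; congr 1; ring
        _ = _ := ih
  -- A multiple of the period `d + 1` that lies beyond the preperiod `i`.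
  refine ⟨(i + 1) * (d + 1), by positivity, ?_⟩
  rw [← pow_add]
  have h := hper (i * d + d + 1) (i + 1)
  have h1 : i + (i * d + d + 1) = (i + 1) * (d + 1) := by ring
  rwa [h1] at h

theorem leftFixingUnits_ne_top {e : R} (h : 2 * e ≠ 0) : leftFixingUnits e ≠ ⊤ := by
  intro htop
  have h1 : (-1 : Rˣ) ∈ leftFixingUnits e := htop ▸ Subgroup.mem_top _
  rw [mem_leftFixingUnits, Units.val_neg, Units.val_one, mul_neg, mul_one] at h1
  refine h ?_
  rw [two_mul]
  nth_rewrite 1 [← h1]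
  exact neg_add_cancel e

variable [Finite R]

/-- Some power of `x` is idempotent, hence central. Were it neither 0 nor 1, `-1` would show both
Peirce factors of `Rˣ` to be proper, so `Rˣ` would be nilpotent. -/
theorem IsMinimalNonNilpotent.isNilpotent_or_isUnit (hR : IsMinimalNonNilpotent Rˣ) {n : ℕ}
    (hn : Odd n) (hnR : (n : R) = 0) (x : R) : IsNilpotent x ∨ IsUnit x := by
  obtain ⟨k, hk, he⟩ := exists_pow_isIdempotentElem_of_finite x
  by_cases h0 : x ^ k = 0
  · exact Or.inl ⟨k, h0⟩
  by_cases h1 : 1 - x ^ k = 0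
  · exact Or.inr (IsUnit.of_pow_eq_one (sub_eq_zero.mp h1).symm hk.ne')
  have hA := hR.2 _ (leftFixingUnits_ne_top fun h ↦ h0 (eq_zero_of_two_mul_eq_zero hn hnR h))
  have hB := hR.2 _ (leftFixingUnits_ne_top fun h ↦ h1 (eq_zero_of_two_mul_eq_zero hn hnR h))
  exact absurd (isNilpotent_units_of_central_idempotent he (hR.commute_idempotent hn hnR he)) hR.1

theorem mem_jacobson_of_not_isUnit (hR : ∀ x : R, IsNilpotent x ∨ IsUnit x) {x : R}
    (hx : ¬ IsUnit x) : x ∈ Ring.jacobson R := by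
  refine mem_jacobson_of_forall_isUnit fun y ↦ IsNilpotent.isUnit_one_add ?_
  refine (hR (y * x)).resolve_right fun h ↦ hx ?_
  obtain ⟨u, hu⟩ := h
  have h1 : (u⁻¹ : Rˣ) * y * x = 1 := by rw [mul_assoc, ← hu, Units.inv_mul]
  exact ⟨⟨x, _, mul_eq_one_symm_of_finite h1, h1⟩, rfl⟩

theorem notMem_jacobson_of_isUnit [Nontrivial R] {x : R} (hx : IsUnit x) :
    x ∉ Ring.jacobson R := by
  obtain ⟨u, rfl⟩ := hx
  intro h
  have h1 := isUnit_one_add_of_mem_jacobson ((Ring.jacobson R).mul_mem_left (-(u⁻¹ : Rˣ)) h)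
  rw [neg_mul, Units.inv_mul, add_neg_cancel] at h1
  exact not_isUnit_zero h1

theorem mul_comm_quotient_jacobson [Nontrivial R] (hR : ∀ x : R, IsNilpotent x ∨ IsUnit x)
    (x y : R ⧸ Ring.jacobson R) : x * y = y * x := by
  have hnt : Nontrivial (R ⧸ Ring.jacobson R) := by
    refine ⟨0, 1, fun h ↦ notMem_jacobson_of_isUnit (R := R) isUnit_one ?_⟩
    rw [← Ideal.Quotient.eq_zero_iff_mem, map_one, h]
  have hunit : ∀ q : R ⧸ Ring.jacobson R, q ≠ 0 → IsUnit q := by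
    intro q hq
    obtain ⟨r, rfl⟩ := Ideal.Quotient.mk_surjective q
    by_contra h
    refine hq (Ideal.Quotient.eq_zero_iff_mem.mpr (mem_jacobson_of_not_isUnit hR fun h1 ↦ h ?_))
    exact h1.map _
  have hnz : NoZeroDivisors (R ⧸ Ring.jacobson R) := by
    refine ⟨fun {a b} hab ↦ or_iff_not_imp_left.mpr fun ha ↦ ?_⟩
    exact (hunit a ha).mul_right_eq_zero.mp hab
  have hdom : IsDomain (R ⧸ Ring.jacobson R) := NoZeroDivisors.to_isDomain _
  exact (Finite.isDomain_to_isField (R ⧸ Ring.jacobson R)).mul_comm x y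

theorem isNilpotent_of_forall_mul_comm {Q : Type*} [Group Q] (h : ∀ x y : Q, x * y = y * x) :
    Group.IsNilpotent Q :=
  letI : CommGroup Q := { (inferInstance : Group Q) with mul_comm := h }
  CommGroup.isNilpotent

/-- If `R` is the sum of its Jacobson radical and the centralizer of the radical, and the
units of the residue ring commute, then the units of `R` form a nilpotent group. -/
theorem isNilpotent_units_of_centralizer_add_jacobson
    (hQ : ∀ x y : (R ⧸ Ring.jacobson R)ˣ, x * y = y * x)
    [Group.IsNilpotent (unitsModJacobson R).ker]
    (h : ∀ r : R, ∃ s : R, (∀ y ∈ Ring.jacobson R, s * y = y * s) ∧ r - s ∈ Ring.jacobson R) :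
    Group.IsNilpotent Rˣ := by
  set A : Subgroup Rˣ := Subgroup.centralizer ((unitsModJacobson R).ker : Set Rˣ) with hA
  have := isNilpotent_of_forall_mul_comm hQ
  have hAnil : Group.IsNilpotent A := by
    -- `A` is a central extension of an abelian group: the kernel of reduction on `A` lies in `1 +
    -- J`, which `A` centralizes.
    refine Subgroup.isNilpotent_of_ker_le_center ((unitsModJacobson R).comp A.subtype) ?_
    intro a ha
    rw [Subgroup.mem_center_iff]
    intro b
    exact Subtype.ext (Subgroup.mem_centralizer_iff.mp b.2 a ha).symm
  refine Group.isNilpotent_of_commuting_subgroups A (unitsModJacobson R).ker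
    (fun a ha p hp ↦ (Subgroup.mem_centralizer_iff.mp ha p hp).symm) fun g ↦ ?_
  obtain ⟨s, hs, hgs⟩ := h g
  obtain ⟨a, rfl⟩ : IsUnit s := by
    refine isUnit_of_isUnit_mk_jacobson ?_
    rw [← Ideal.Quotient.eq.mpr hgs]
    exact g.isUnit.map _
  refine ⟨a, Subgroup.mem_centralizer_iff.mpr fun p hp ↦ Units.ext ?_, a⁻¹ * g, ?_, by simp⟩
  · have h1 := hs _ (mem_ker_unitsModJacobson.mp hp)
    rw [Units.val_mul, Units.val_mul]
    simpa [mul_sub, sub_mul] using h1.symm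
  · rw [MonoidHom.mem_ker, map_mul, map_inv, inv_mul_eq_one, eq_comm]
    exact unitsModJacobson_eq_iff.mpr hgs

theorem not_isMinimalNonNilpotent_units_of_odd {n : ℕ} (hn : Odd n) (hnR : (n : R) = 0) :
    ¬ IsMinimalNonNilpotent Rˣ := by
  intro hR
  have hnt : Nontrivial R := by
    rw [← not_subsingleton_iff_nontrivial]
    intro h
    exact hR.1 inferInstance
  have hloc := hR.isNilpotent_or_isUnit hn hnR
  have hcomm := mul_comm_quotient_jacobson hloc
  have hQ : ∀ x y : (R ⧸ Ring.jacobson R)ˣ, x * y = y * x := fun x y ↦ Units.ext (hcomm x y)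
  have hQnil := isNilpotent_of_forall_mul_comm hQ
  obtain ⟨p, hp, hpQ⟩ : ∃ p : ℕ, p.Prime ∧ IsPGroup p (R ⧸ Ring.jacobson R)ˣ := by
    by_contra! h
    exact hR.1 (Group.isNilpotent_of_surjective_of_not_isPGroup _ unitsModJacobson_surjective h hR.2)
  have hneg : unitsModJacobson R (-1) ≠ 1 := by
    intro h
    have h1 := mem_ker_unitsModJacobson.mp (MonoidHom.mem_ker.mpr h)
    refine notMem_jacobson_of_isUnit (R := R) isUnit_one ?_
    obtain ⟨k, rfl⟩ := hn
    have h2 := (Ring.jacobson R).mul_mem_left (k : R) h1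
    have h3 : (k : R) * (((-1 : Rˣ) : R) - 1) = 1 := by
      rw [Units.val_neg, Units.val_one]
      push_cast at hnR
      calc (k : R) * (-1 - 1) = 1 - (2 * k + 1) := by
            rw [mul_sub, mul_neg, mul_one, two_mul]; abel
        _ = 1 := by rw [hnR, sub_zero]
    rwa [h3] at h2
  have hnegsq : unitsModJacobson R (-1) ^ 2 = 1 := by
    rw [← map_pow, neg_one_sq, map_one]
  have hp2 : p = 2 := by
    have : Fact (Nat.Prime 2) := ⟨Nat.prime_two⟩
    have : Fact p.Prime := ⟨hp⟩
    have h2 := orderOf_eq_prime hnegsq hneg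
    obtain ⟨k, hk⟩ := IsPGroup.iff_orderOf.mp hpQ (unitsModJacobson R (-1))
    rw [h2] at hk
    exact ((Nat.prime_dvd_prime_iff_eq Nat.prime_two hp).mp
      (Nat.prime_two.dvd_of_dvd_pow hk.dvd)).symm
  subst hp2
  have : Fact (Nat.Prime 2) := ⟨Nat.prime_two⟩
  obtain ⟨k, hk⟩ := IsPGroup.iff_card.mp hpQ
  -- Squaring kills `-1 ≠ 1`, so it is not onto, and the preimage of the squares is a proper
  -- subgroup.
  let sq : (R ⧸ Ring.jacobson R)ˣ →* (R ⧸ Ring.jacobson R)ˣ :=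
    { toFun := fun x ↦ x ^ 2
      map_one' := one_pow 2
      map_mul' := fun x y ↦ Commute.mul_pow (hQ x y) 2 }
  set N : Subgroup Rˣ := sq.range.comap (unitsModJacobson R) with hN
  have hNtop : N ≠ ⊤ := by
    intro h
    have hsurj : Function.Surjective sq := by
      intro q
      obtain ⟨g, rfl⟩ := unitsModJacobson_surjective q
      have : g ∈ N := h ▸ Subgroup.mem_top g
      exact this
    have hinj := Finite.injective_iff_surjective.mpr hsurj
    exact hneg (hinj (hnegsq.trans (one_pow 2).symm))
  have hNnil := hR.2 N hNtop
  have hPN : (unitsModJacobson R).ker ≤ N := fun g hg ↦ by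
    rw [hN, Subgroup.mem_comap, MonoidHom.mem_ker.mp hg]
    exact one_mem _
  have hPnil : Group.IsNilpotent (unitsModJacobson R).ker :=
    hR.2 _ fun h ↦ hneg (MonoidHom.mem_ker.mp (h ▸ Subgroup.mem_top _))
  have hodd := odd_card_jacobson hn hnR
  rw [← card_ker_unitsModJacobson] at hodd
  set c := Nat.card (unitsModJacobson R).ker with hc
  have hcop : c.Coprime (2 ^ k) := (Nat.coprime_two_right.mpr hodd).pow_right k
  have hunit : ∀ g : Rˣ, ∃ s : R, (∀ y ∈ Ring.jacobson R, s * y = y * s) ∧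
      (g * g : R) - s ∈ Ring.jacobson R := by
    intro g
    -- `E ≡ 1` modulo `2 ^ k` and `c ∣ E`: the power `g ^ E` keeps the residue class of `g` but has
    -- 2-power order.
    set E := c ^ (2 ^ k).totient with hE
    have hcE : c ∣ E := dvd_pow_self c (Nat.totient_pos.mpr (by positivity)).ne'
    have hgE : unitsModJacobson R (g ^ E) = unitsModJacobson R g := by
      rw [map_pow]
      nth_rewrite 2 [← pow_one (unitsModJacobson R g)]
      rw [pow_eq_pow_iff_modEq]
      exact (Nat.ModEq.pow_totient hcop).of_dvd (hk ▸ orderOf_dvd_natCard _)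
    have hpow : (g ^ E * g ^ E) ^ 2 ^ k = 1 := by
      have h1 : g ^ 2 ^ k ∈ (unitsModJacobson R).ker := by
        rw [MonoidHom.mem_ker, map_pow, ← hk, pow_card_eq_one']
      have h2 : (g ^ 2 ^ k) ^ c = 1 := by
        have := pow_card_eq_one' (x := (⟨_, h1⟩ : (unitsModJacobson R).ker))
        exact congrArg Subtype.val this
      have h3 : (g ^ E) ^ 2 ^ k = 1 := by
        obtain ⟨d, hd⟩ := hcE
        rw [hd, ← pow_mul, mul_comm, pow_mul, pow_mul, h2, one_pow]
      rw [(Commute.refl _).mul_pow, h3, one_mul]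
    have hmem : g ^ E * g ^ E ∈ N := ⟨unitsModJacobson R (g ^ E), by
      rw [map_mul]; exact pow_two _⟩
    refine ⟨(g ^ E * g ^ E : Rˣ), fun y hy ↦ ?_, ?_⟩
    · refine commute_coe_of_commute_ker_unitsModJacobson (fun p hp ↦ ?_) hy
      have h1 : Commute (⟨_, hmem⟩ : N) ⟨p, hPN hp⟩ := by
        refine Group.IsNilpotent.commute_of_coprime_orderOf ?_
        rw [Subgroup.orderOf_mk, Subgroup.orderOf_mk]
        refine Nat.Coprime.coprime_dvd_left (orderOf_dvd_of_pow_eq_one hpow) ?_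
        refine Nat.Coprime.coprime_dvd_right ?_ hcop.symm
        have := orderOf_dvd_natCard (⟨p, hp⟩ : (unitsModJacobson R).ker)
        rwa [Subgroup.orderOf_mk] at this
      exact congrArg Subtype.val h1
    · rw [← Units.val_mul, ← unitsModJacobson_eq_iff, map_mul, map_mul, hgE]
  have hsq : ∀ r : R, ∃ s : R, (∀ y ∈ Ring.jacobson R, s * y = y * s) ∧
      r * r - s ∈ Ring.jacobson R := by
    intro r
    by_cases hr : IsUnit r
    · obtain ⟨g, rfl⟩ := hr
      exact hunit g
    · refine ⟨0, fun y _ ↦ by simp, ?_⟩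
      rw [sub_zero]
      exact (Ring.jacobson R).mul_mem_left r (mem_jacobson_of_not_isUnit hloc hr)
  refine hR.1 (isNilpotent_units_of_centralizer_add_jacobson hQ fun r ↦ ?_)
  obtain ⟨s₁, hs₁, h₁⟩ := hsq (r + 1)
  obtain ⟨s₂, hs₂, h₂⟩ := hsq (r - 1)
  obtain ⟨l, rfl⟩ := hn
  -- The inverse of 4: with `n = 2l + 1`, one has `4(l + 1)² = (n + 1)² = 1 + n(n + 2)`.
  set q : R := (((l + 1) ^ 2 : ℕ) : R) with hq
  have hq4 : q * 4 = 1 := by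
    have : q * 4 = 1 + ((2 * l + 1 : ℕ) : R) * ((2 * l + 3 : ℕ) : R) := by
      rw [hq]
      have h4 : (4 : R) = ((4 : ℕ) : R) := by norm_num
      rw [h4]
      norm_cast
      congr 1
      ring
    rw [this, hnR, zero_mul, add_zero]
  refine ⟨q * (s₁ - s₂), fun y hy ↦ ?_, ?_⟩
  · rw [mul_assoc, sub_mul, hs₁ y hy, hs₂ y hy, ← mul_sub, ← mul_assoc,
      (Nat.cast_commute _ y : Commute q y).eq, mul_assoc]
  · have h3 := (Ring.jacobson R).mul_mem_left q ((Ring.jacobson R).sub_mem h₁ h₂)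
    have h4 : q * ((r + 1) * (r + 1) - s₁ - ((r - 1) * (r - 1) - s₂)) = r - q * (s₁ - s₂) := by
      calc q * ((r + 1) * (r + 1) - s₁ - ((r - 1) * (r - 1) - s₂))
          = q * 4 * r - q * (s₁ - s₂) := by noncomm_ring
        _ = _ := by rw [hq4, one_mul]
    rwa [h4] at h3

theorem odd_part_eq_one_of_isMinimalNonNilpotent_units {a m : ℕ} (hm : Odd m)
    (hcard : Nat.card R = 2 ^ a * m) (hR : IsMinimalNonNilpotent Rˣ) : m = 1 := by
  by_contra hm1
  have hcop : (2 ^ a).Coprime m := (Nat.coprime_two_left.mpr hm).pow_left a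
  -- The integer `c` yields the central idempotent projecting onto the odd component.
  obtain ⟨c, hc0, hc1⟩ := Nat.chineseRemainder hcop 0 1
  have hcast : ∀ k : ℕ, 2 ^ a * m ∣ k → (k : R) = 0 := by
    rintro _ ⟨d, rfl⟩
    rw [← nsmul_one, mul_comm, mul_nsmul', ← hcard, card_nsmul_eq_zero', nsmul_zero]
  have hmodEq : ∀ x y : ℕ, x ≡ y [MOD 2 ^ a * m] → (x : R) = y := by
    intro x y h
    rw [Nat.modEq_iff_dvd] at h
    obtain ⟨d, hd⟩ := h
    have h1 : ((y : ℤ) : R) - ((x : ℤ) : R) = 0 := by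
      rw [← Int.cast_sub, hd, Int.cast_mul, Int.cast_natCast, hcast _ dvd_rfl, zero_mul]
    rw [Int.cast_natCast, Int.cast_natCast, sub_eq_zero] at h1
    exact h1.symm
  set e : R := (c : R) with he_def
  have he : e * e = e := by
    rw [he_def, ← Nat.cast_mul]
    refine hmodEq _ _ ((Nat.modEq_and_modEq_iff_modEq_mul hcop).mp ⟨?_, ?_⟩)
    · exact (hc0.mul hc0).trans hc0.symm
    · exact (hc1.mul hc1).trans hc1.symm
  have hec : ∀ r : R, Commute e r := fun r ↦ Nat.cast_commute c r
  have hem : e * m = 0 := by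
    rw [he_def, ← Nat.cast_mul]
    exact hcast _ (mul_dvd_mul_right ((Nat.modEq_zero_iff_dvd).mp hc0) m)
  have he2 : 2 * e ≠ 0 := by
    obtain ⟨l, hl, hlm⟩ := Nat.exists_prime_and_dvd hm1
    have : Fact l.Prime := ⟨hl⟩
    obtain ⟨r, hr⟩ := exists_prime_addOrderOf_dvd_card' (G := R) l
      (hcard ▸ hlm.mul_left _)
    intro h
    have h1 : ((2 * c : ℕ) : R) * r = 0 := by
      push_cast
      rw [← he_def, h, zero_mul]
    rw [← nsmul_eq_mul] at h1
    have h2 := addOrderOf_dvd_of_nsmul_eq_zero h1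
    rw [hr] at h2
    have h3 : ¬ l ∣ c := by
      intro h4
      have h5 := hc1.of_dvd hlm
      exact hl.one_lt.ne' (Nat.dvd_one.mp ((h5.dvd_iff dvd_rfl).mp h4))
    rcases hl.dvd_mul.mp h2 with h4 | h4
    · rw [(Nat.prime_dvd_prime_iff_eq hl Nat.prime_two).mp h4] at hlm
      exact Nat.not_even_iff_odd.mpr hm (even_iff_two_dvd.mpr hlm)
    · exact h3 h4
  have htop : leftFixingUnits (1 - e) = ⊤ := by
    by_contra h
    have hA := hR.2 _ (leftFixingUnits_ne_top he2)
    have hB := hR.2 _ h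
    exact hR.1 (isNilpotent_units_of_central_idempotent he hec)
  let I : Ideal R := Ideal.span {(m : R)}
  have hI : I.IsTwoSided := ⟨fun {x} y hx ↦ by
    obtain ⟨r, rfl⟩ := Ideal.mem_span_singleton'.mp hx
    refine Ideal.mem_span_singleton'.mpr ⟨r * y, ?_⟩
    rw [mul_assoc, mul_assoc, (Nat.cast_commute m y).eq]⟩
  have heI : ∀ x ∈ I, e * x = 0 := by
    intro x hx
    obtain ⟨r, rfl⟩ := Ideal.mem_span_singleton'.mp hx
    rw [(Nat.cast_commute m r).symm.eq, ← mul_assoc, hem, zero_mul]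
  have h1e : 1 - e ∈ I := by
    rw [Nat.modEq_iff_dvd] at hc1
    obtain ⟨d, hd⟩ := hc1
    refine Ideal.mem_span_singleton'.mpr ⟨(d : R), ?_⟩
    have := congrArg (Int.cast : ℤ → R) hd
    push_cast at this
    rw [this, (Nat.cast_commute m (d : R)).eq]
  -- All units are trivial on the 2-component, so passing to the odd-characteristic ring `R / mR`
  -- loses none of them.
  have hbij : Function.Bijective (Units.map (Ideal.Quotient.mk I : R →* R ⧸ I)) := by
    constructor
    · rw [injective_iff_map_eq_one]
      intro g hg
      have h1 : (g : R) - 1 ∈ I := by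
        rw [← Ideal.Quotient.eq, map_one]
        exact congrArg Units.val hg
      have h2 : (1 - e) * (g : R) = 1 - e :=
        mem_leftFixingUnits.mp (htop ▸ Subgroup.mem_top g)
      have h3 := heI _ h1
      refine Units.ext ?_
      calc (g : R) = (1 - e) * g + e * (g - 1) + e := by noncomm_ring
        _ = 1 := by rw [h2, h3]; simp
    · intro q
      obtain ⟨r, hr⟩ := Ideal.Quotient.mk_surjective q.val
      obtain ⟨s, hs⟩ := Ideal.Quotient.mk_surjective (q⁻¹ : (R ⧸ I)ˣ).val
      have hrs : e * (r * s) = e := by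
        have h1 : r * s - 1 ∈ I := by
          rw [← Ideal.Quotient.eq, map_mul, hr, hs, map_one, Units.mul_inv]
        have h2 := heI _ h1
        rw [mul_sub, mul_one, sub_eq_zero] at h2
        exact h2
      have hgh : (e * r + (1 - e)) * (e * s + (1 - e)) = 1 := by
        calc (e * r + (1 - e)) * (e * s + (1 - e))
            = e * (r * e) * s + e * (r * (1 - e)) + (1 - e) * e * s + (1 - e) * (1 - e) := by
              noncomm_ring
          _ = e * e * (r * s) + (e * r - e * e * r) + (e - e * e) * s + (1 - e - e + e * e) := by
              rw [← (hec r).eq, mul_sub r, ← (hec r).eq]; noncomm_ring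
          _ = 1 := by rw [he, hrs]; simp
      refine ⟨⟨_, _, hgh, mul_eq_one_symm_of_finite hgh⟩, Units.ext ?_⟩
      change Ideal.Quotient.mk I (e * r + (1 - e)) = q.val
      rw [← hr, Ideal.Quotient.eq]
      have h1 : e * r + (1 - e) - r = (1 - e) * (1 - r) := by noncomm_ring
      rw [h1]
      exact hI.mul_mem_of_left _ h1e
  refine not_isMinimalNonNilpotent_units_of_odd (R := R ⧸ I) hm ?_
    (hR.of_mulEquiv (MulEquiv.ofBijective _ hbij))
  rw [← map_natCast (Ideal.Quotient.mk I), Ideal.Quotient.eq_zero_iff_mem]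
  exact Ideal.mem_span_singleton_self _

end OddCharacteristic

/-! ### Two involutions satisfying the braid relation -/

section BraidInvolutions

variable {Q : Type*} [Group Q] {u v : Q}

theorem mul_pow_three_eq_one_of_braid (hu : u * u = 1) (hv : v * v = 1)
    (huv : u * v * u = v * u * v) : (u * v) ^ 3 = 1 := by
  calc (u * v) ^ 3 = u * v * u * (v * u * v) := by simp only [pow_succ, pow_zero, one_mul, mul_assoc]
    _ = u * v * (u * u) * v * u := by rw [← huv]; simp only [mul_assoc]
    _ = 1 := by rw [hu, mul_one, mul_assoc u, hv, mul_one, hu]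

theorem conj_mul_eq_inv_of_involutions (hu : u * u = 1) (hv : v * v = 1) :
    u * (u * v) * u⁻¹ = (u * v)⁻¹ := by
  rw [mul_inv_rev, ← mul_assoc, hu, one_mul, inv_eq_of_mul_eq_one_left hv]

theorem mem_closure_braid_involutions (hu : u * u = 1) (hv : v * v = 1)
    (huv : u * v * u = v * u * v) {g : Q} (hg : g ∈ Subgroup.closure {u, v}) :
    g = 1 ∨ g = u ∨ g = v ∨ g = u * v ∨ g = v * u ∨ g = u * v * u := by
  have hu' : u⁻¹ = u := inv_eq_of_mul_eq_one_left hu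
  have hv' : v⁻¹ = v := inv_eq_of_mul_eq_one_left hv
  have hstep : ∀ x ∈ ({u, v} : Set Q), ∀ y,
      (y = 1 ∨ y = u ∨ y = v ∨ y = u * v ∨ y = v * u ∨ y = u * v * u) →
      (x * y = 1 ∨ x * y = u ∨ x * y = v ∨ x * y = u * v ∨ x * y = v * u ∨
        x * y = u * v * u) := by
    have huu : ∀ z, u * (u * z) = z := fun z ↦ by rw [← mul_assoc, hu, one_mul]
    have hvv : ∀ z, v * (v * z) = z := fun z ↦ by rw [← mul_assoc, hv, one_mul]
    rintro x (rfl | rfl) y (rfl | rfl | rfl | rfl | rfl | rfl)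
    · simp
    · simp [hu]
    · simp
    · simp [huu]
    · simp [mul_assoc]
    · simp [mul_assoc, huu]
    · simp
    · simp
    · simp [hv]
    · rw [← mul_assoc, ← huv]; simp
    · simp [hvv]
    · rw [huv, mul_assoc, hvv]; simp
  induction hg using Subgroup.closure_induction_left with
  | one => exact Or.inl rfl
  | mul_left x hx y _ ih => exact hstep x hx y ih
  | inv_mul_cancel x hx y _ ih =>
    have hx' : x⁻¹ = x := by
      rcases hx with rfl | rfl
      · exact hu'
      · exact hv'
    rw [hx']
    exact hstep x hx y ih

theorem card_le_six_of_braid_involutions (hu : u * u = 1) (hv : v * v = 1)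
    (huv : u * v * u = v * u * v) (htop : Subgroup.closure {u, v} = ⊤) : Nat.card Q ≤ 6 := by
  classical
  have h : ∀ g : Q, g ∈ ({1, u, v, u * v, v * u, u * v * u} : Finset Q) := fun g ↦ by
    simpa using mem_closure_braid_involutions hu hv huv (htop ▸ Subgroup.mem_top g)
  have : Fintype Q := ⟨_, h⟩
  rw [Nat.card_eq_fintype_card]
  exact (Finset.card_le_card (fun g _ ↦ h g)).trans Finset.card_le_six

end BraidInvolutions

/-! ### Matrix units in the Wedderburn decomposition -/

section MatrixUnits

theorem exists_matrix_units_of_pi_matrix {S : Type*} [Ring S] {n : ℕ} {D : Fin n → Type*}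
    {d : Fin n → ℕ} [∀ i, DivisionRing (D i)]
    (φ : S ≃+* Π i, Matrix (Fin (d i)) (Fin (d i)) (D i)) {i : Fin n} (hi : 2 ≤ d i) :
    ∃ x y : S, x ≠ 0 ∧ x * x = 0 ∧ y * y = 0 ∧ x * y * x = x ∧ y * x * y = y := by
  let j₀ : Fin (d i) := ⟨0, by omega⟩
  let j₁ : Fin (d i) := ⟨1, by omega⟩
  have hj : j₀ ≠ j₁ := by simp [j₀, j₁, Fin.ext_iff]
  refine ⟨φ.symm (Pi.single i (Matrix.single j₀ j₁ 1)), φ.symm (Pi.single i (Matrix.single j₁ j₀ 1)),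
    ?_, ?_, ?_, ?_, ?_⟩
  · rw [Ne, map_eq_zero_iff _ φ.symm.injective, Pi.single_eq_zero_iff]
    intro h
    have := congrFun (congrFun h j₀) j₁
    simp at this
  all_goals
    simp only [← map_mul, ← Pi.single_mul]
    simp [Matrix.single_mul_single_of_ne, hj, hj.symm]

theorem finite_coefficients_of_pi_matrix {S : Type*} [Ring S] [Finite S] {n : ℕ}
    {D : Fin n → Type*} {d : Fin n → ℕ} [∀ i, DivisionRing (D i)] [∀ i, NeZero (d i)]
    (φ : S ≃+* Π i, Matrix (Fin (d i)) (Fin (d i)) (D i)) (i : Fin n) : Finite (D i) := by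
  refine Finite.of_surjective (fun s ↦ φ s i 0 0) fun x ↦ ?_
  exact ⟨φ.symm (Pi.single i (Matrix.of fun _ _ ↦ x)), by simp⟩

/-- If all blocks had size 1, little Wedderburn would make `S` commutative. -/
theorem exists_two_le_of_not_isNilpotent_units {S : Type*} [Ring S] [Finite S] {n : ℕ}
    {D : Fin n → Type*} {d : Fin n → ℕ} [∀ i, DivisionRing (D i)] [∀ i, NeZero (d i)]
    (φ : S ≃+* Π i, Matrix (Fin (d i)) (Fin (d i)) (D i)) (hS : ¬ Group.IsNilpotent Sˣ) :
    ∃ i, 2 ≤ d i := by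
  by_contra! h
  refine hS (isNilpotent_of_forall_mul_comm fun u v ↦ Units.ext (φ.injective ?_))
  rw [Units.val_mul, Units.val_mul, map_mul, map_mul]
  funext i
  have := finite_coefficients_of_pi_matrix φ i
  have hsub : Subsingleton (Fin (d i)) := Fin.subsingleton_iff_le_one.mpr (by have := h i; omega)
  ext k l
  rw [Pi.mul_apply, Pi.mul_apply, Matrix.mul_apply, Matrix.mul_apply]
  refine Finset.sum_congr rfl fun j _ ↦ ?_
  rw [Subsingleton.elim k j, Subsingleton.elim l j]
  exact (littleWedderburn (D i)).mul_comm _ _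

/-- A pair of off-diagonal matrix units in characteristic two gives braiding involutions. -/
theorem exists_braid_involutions {S : Type*} [Ring S] (h2 : (2 : S) = 0) {x y : S} (hx0 : x ≠ 0)
    (hx : x * x = 0) (hy : y * y = 0) (hxyx : x * y * x = x) (hyxy : y * x * y = y) :
    ∃ u v : Sˣ, u ≠ v ∧ u * u = 1 ∧ v * v = 1 ∧ u * v * u = v * u * v := by
  have hadd : ∀ z : S, z + z = 0 := fun z ↦ by rw [← two_mul, h2, zero_mul]
  have hsq : ∀ (z : S) (hz : z * z = 0), transvectionUnit z hz * transvectionUnit z hz = 1 := by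
    intro z hz
    refine Units.ext ?_
    change (1 + z) * (1 + z) = 1
    calc (1 + z) * (1 + z) = 1 + (z + z) + z * z := by noncomm_ring
      _ = 1 := by rw [hadd, hz]; simp
  refine ⟨transvectionUnit x hx, transvectionUnit y hy, fun h ↦ hx0 ?_, hsq x hx, hsq y hy, ?_⟩
  · have h1 : 1 + x = 1 + y := congrArg Units.val h
    rw [← hxyx, ← add_left_cancel h1, hx, zero_mul]
  · refine Units.ext ?_
    change (1 + x) * (1 + y) * (1 + x) = (1 + y) * (1 + x) * (1 + y)
    calc (1 + x) * (1 + y) * (1 + x)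
        = 1 + (x + x) + y + x * y + y * x + x * x + x * y * x := by noncomm_ring
      _ = 1 + (y + y) + x + x * y + y * x + y * y + y * x * y := by
        rw [hadd, hadd, hx, hy, hxyx, hyxy]; abel
      _ = _ := by noncomm_ring

end MatrixUnits

/-! ### Vanishing of the radical in rings of 2-power order -/

section TwoPower

variable {R : Type*} [Ring R]

theorem two_pow_eq_zero_of_card {a : ℕ} (hcard : Nat.card R = 2 ^ a) : (2 : R) ^ a = 0 := by
  have : ((2 ^ a : ℕ) : R) = 0 := by
    rw [← nsmul_one, ← hcard, card_nsmul_eq_zero']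
  exact_mod_cast this

theorem two_mem_jacobson {a : ℕ} (ha : (2 : R) ^ a = 0) : (2 : R) ∈ Ring.jacobson R := by
  refine mem_jacobson_of_forall_isUnit fun y ↦ IsNilpotent.isUnit_one_add ⟨a, ?_⟩
  have h : Commute y 2 := by simpa using (Nat.cast_commute 2 y).symm
  rw [h.mul_pow, ha, mul_zero]

variable [Finite R]

theorem pow_eq_one_of_mem_ker_unitsModJacobson {a : ℕ} (hcard : Nat.card R = 2 ^ a) {p : Rˣ}
    (hp : p ∈ (unitsModJacobson R).ker) : p ^ 2 ^ a = 1 := by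
  rw [← orderOf_dvd_iff_pow_eq_one, ← hcard]
  refine dvd_trans ?_ (card_jacobson_dvd (R := R))
  rw [← card_ker_unitsModJacobson]
  have := orderOf_dvd_natCard (⟨p, hp⟩ : (unitsModJacobson R).ker)
  rwa [Subgroup.orderOf_mk] at this

/-- Lift the pair to `w` of order 3 inverted by `t`, and let `e` be the idempotent `(1 + w + w²)/3`.
Here `w` centralizes `1 + J`, by coprime orders in a proper subgroup. The pair, cut down to `1 - e`,
is still non-nilpotent and fixes `e`; so every unit fixes `e`, giving `eJ = 0`. But `w` acts
trivially on `J`, so `e` acts on `J` as 1. -/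
theorem jacobson_eq_bot_of_conj_eq_inv {a : ℕ} (hcard : Nat.card R = 2 ^ a)
    (hR : IsMinimalNonNilpotent Rˣ) {wbar tbar : (R ⧸ Ring.jacobson R)ˣ} (hw3 : wbar ^ 3 = 1)
    (hw1 : wbar ≠ 1) (htw : tbar * wbar * tbar⁻¹ = wbar⁻¹) : Ring.jacobson R = ⊥ := by
  have hker := fun p hp ↦ pow_eq_one_of_mem_ker_unitsModJacobson hcard (p := p) hp
  obtain ⟨w₀, hw₀⟩ := unitsModJacobson_surjective wbar
  obtain ⟨w, hww, hwcube⟩ : ∃ w : Rˣ, unitsModJacobson R w = wbar ∧ w ^ 3 = 1 := by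
    -- `4 ^ a ≡ 1` modulo 3 preserves the image, while `2 ^ a ∣ 4 ^ a` kills `w₀ ^ 3`, which lies in
    -- the 2-group `1 + J`.
    refine ⟨w₀ ^ 4 ^ a, ?_, ?_⟩
    · rw [map_pow, hw₀]
      clear hcard hker
      induction a with
      | zero => simp
      | succ a ih => rw [pow_succ 4, pow_mul, ih, pow_succ, hw3, one_mul]
    · have h1 : w₀ ^ 3 ∈ (unitsModJacobson R).ker := by rw [MonoidHom.mem_ker, map_pow, hw₀, hw3]
      have h4 : 4 ^ a = 2 ^ a * 2 ^ a := by rw [← mul_pow]; norm_num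
      rw [← pow_mul, mul_comm, pow_mul, h4, pow_mul, hker _ h1, one_pow]
  have hwP : ∀ p ∈ (unitsModJacobson R).ker, Commute w p := by
    intro p hp
    set K := (Subgroup.zpowers wbar).comap (unitsModJacobson R) with hK
    have hKtop : K ≠ ⊤ := by
      intro h
      obtain ⟨t, ht⟩ := unitsModJacobson_surjective tbar
      have h1 : t ∈ K := h ▸ Subgroup.mem_top t
      rw [hK, Subgroup.mem_comap, ht] at h1
      obtain ⟨z, hz⟩ := Subgroup.mem_zpowers_iff.mp h1
      have hcomm : Commute tbar wbar := by
        rw [← hz]; exact (Commute.refl wbar).zpow_left z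
      rw [hcomm.eq, mul_inv_cancel_right] at htw
      apply hw1
      calc wbar = wbar ^ 3 * (wbar * wbar)⁻¹ := by group
        _ = 1 := by nth_rewrite 3 [htw]; rw [hw3]; simp
    have hKnil := hR.2 K hKtop
    have hwK : w ∈ K := by
      rw [hK, Subgroup.mem_comap, hww]; exact Subgroup.mem_zpowers _
    have hpK : p ∈ K := by
      rw [hK, Subgroup.mem_comap, MonoidHom.mem_ker.mp hp]; exact one_mem _
    have h1 : Commute (⟨w, hwK⟩ : K) ⟨p, hpK⟩ := by
      refine Group.IsNilpotent.commute_of_coprime_orderOf ?_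
      rw [Subgroup.orderOf_mk, Subgroup.orderOf_mk]
      refine Nat.Coprime.coprime_dvd_left (orderOf_dvd_of_pow_eq_one hwcube) ?_
      refine Nat.Coprime.coprime_dvd_right (orderOf_dvd_of_pow_eq_one (hker p hp)) ?_
      exact Nat.Coprime.pow_right a (by norm_num)
    exact congrArg Subtype.val h1
  obtain ⟨t, htt⟩ := unitsModJacobson_surjective tbar
  have htwu : t * w * t⁻¹ = w⁻¹ := by
    -- The error `p` in lifting the inversion relation commutes with `w`, so `p ^ 3 = 1`; it also
    -- has 2-power order, hence is trivial.
    have hp : w * (t * w * t⁻¹) ∈ (unitsModJacobson R).ker := by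
      rw [MonoidHom.mem_ker, map_mul, map_mul, map_mul, map_inv, hww, htt, htw, mul_inv_cancel]
    set p := w * (t * w * t⁻¹) with hpdef
    have h1 : t * w * t⁻¹ = w⁻¹ * p := by rw [hpdef, inv_mul_cancel_left]
    have h2 : p ^ 3 = 1 := by
      have h3 : (t * w * t⁻¹) ^ 3 = 1 := by rw [conj_pow, hwcube]; simp
      rwa [h1, ((hwP p hp).inv_left).mul_pow, inv_pow, hwcube, inv_one, one_mul] at h3
    have h3 : p = 1 := by
      have h4 := pow_gcd_eq_one.mpr ⟨h2, hker p hp⟩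
      rwa [(Nat.Coprime.pow_right a (by norm_num) : Nat.Coprime 3 (2 ^ a)), pow_one] at h4
    rw [h1, h3, mul_one]
  set W : R := (w : R) with hW
  set T : R := (t : R) with hT
  have hW3 : W * W * W = 1 := by
    have := congrArg Units.val hwcube
    simpa [pow_succ] using this
  have hwinv : ((w⁻¹ : Rˣ) : R) = W * W := by
    rw [Units.inv_eq_of_mul_eq_one_right]
    rw [← mul_assoc, ← hW, hW3]
  have hTW : T * W = W * W * T := by
    have h1 : t * w = w⁻¹ * t := by rw [← htwu, inv_mul_cancel_right]
    have := congrArg Units.val h1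
    rwa [Units.val_mul, Units.val_mul, hwinv] at this
  have hTWW : T * (W * W) = W * T := by
    calc T * (W * W) = T * W * W := by rw [mul_assoc]
      _ = W * W * (T * W) := by rw [hTW, mul_assoc (W * W) T W, hTW]
      _ = W * W * W * (W * T) := by rw [hTW]; simp only [mul_assoc]
      _ = W * T := by rw [hW3, one_mul]
  obtain ⟨q, hq3, hqc⟩ : ∃ q : R, q * 3 = 1 ∧ ∀ r, Commute q r := by
    have hk : ∃ k : ℕ, 4 ^ a = 3 * k + 1 := by
      clear hcard hker
      induction a with
      | zero => exact ⟨0, rfl⟩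
      | succ a ih =>
        obtain ⟨k, hk⟩ := ih
        exact ⟨4 * k + 1, by rw [pow_succ, hk]; ring⟩
    obtain ⟨k, hk⟩ := hk
    -- From `4 ^ a = 3k + 1` and `4 ^ a = 0` in `R`, the inverse of 3 is `-k`.
    refine ⟨-(k : R), ?_, fun r ↦ (Nat.cast_commute k r).neg_left⟩
    have h4 : ((4 ^ a : ℕ) : R) = 0 := by
      have : 4 ^ a = 2 ^ a * 2 ^ a := by rw [← mul_pow]; norm_num
      rw [this]
      push_cast
      rw [two_pow_eq_zero_of_card hcard, zero_mul]
    rw [hk] at h4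
    push_cast at h4
    rw [neg_mul, (Nat.cast_commute k (3 : R)).eq]
    exact neg_eq_of_add_eq_zero_right h4
  set s : R := 1 + W + W * W with hs
  have hsW : s * W = s := by
    rw [hs, add_mul, add_mul, hW3, one_mul]; abel
  have hWs : W * s = s := by
    rw [hs, mul_add, mul_add, ← mul_assoc, hW3, mul_one]; abel
  have hss : s * s = 3 * s := by
    nth_rewrite 1 [hs]
    rw [add_mul, add_mul, mul_assoc W W, hWs, hWs, one_mul]
    noncomm_ring
  have hTs : T * s = s * T := by
    rw [hs, mul_add, mul_add, hTW, hTWW]; noncomm_ring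
  set e : R := q * s with he_def
  have hee : e * e = e := by
    calc e * e = q * (s * q) * s := by rw [he_def]; simp only [mul_assoc]
      _ = q * q * (s * s) := by rw [← (hqc s).eq]; simp only [mul_assoc]
      _ = q * (q * 3) * s := by rw [hss]; simp only [mul_assoc]
      _ = e := by rw [hq3, mul_one]
  have heW : e * W = e := by rw [he_def, mul_assoc, hsW]
  have hWe : W * e = e := by
    rw [he_def, ← mul_assoc, ← (hqc W).eq, mul_assoc, hWs]
  have hTe : Commute e T := by
    rw [commute_iff_eq, he_def, mul_assoc, ← hTs, ← mul_assoc, (hqc T).eq, mul_assoc]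
  have hff : (1 - e) * (1 - e) = 1 - e := by
    calc (1 - e) * (1 - e) = 1 - e - e + e * e := by noncomm_ring
      _ = 1 - e := by rw [hee]; abel
  have hfc : Commute (1 - e) T := (Commute.one_left T).sub_left hTe
  have htop : leftFixingUnits e = ⊤ := by
    refine hR.eq_top_of_not_isNilpotent (Subgroup.not_isNilpotent_of_conj_eq_inv (u := w)
      (t := cornerUnit (1 - e) hff t hfc) heW ?_ ?_ (n := 3) (by decide) hwcube ?_)
    · rw [mem_leftFixingUnits]
      change e * ((1 - e) * T + (1 - (1 - e))) = e
      calc e * ((1 - e) * T + (1 - (1 - e))) = (e - e * e) * T + e * e := by noncomm_ring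
        _ = e := by rw [hee]; simp
    · rintro rfl
      exact hw1 (by rw [← hww, map_one])
    · rw [mul_inv_eq_iff_eq_mul]
      refine Units.ext ?_
      rw [Units.val_mul, Units.val_mul, hwinv]
      change ((1 - e) * T + (1 - (1 - e))) * W = W * W * ((1 - e) * T + (1 - (1 - e)))
      calc ((1 - e) * T + (1 - (1 - e))) * W = T * W - e * (T * W) + e * W := by noncomm_ring
        _ = W * W * T - e * W * W * T + e := by rw [hTW, heW]; simp only [← mul_assoc, heW]
        _ = W * W * T - W * (W * e) * T + W * (W * e) := by rw [heW, heW, hWe, hWe]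
        _ = _ := by noncomm_ring
  rw [eq_bot_iff]
  intro y hy
  have hwJ := fun z hz ↦ commute_coe_of_commute_ker_unitsModJacobson hwP (y := z) hz
  have hey : e * y = 0 := by
    obtain ⟨g, hg⟩ := isUnit_one_add_of_mem_jacobson hy
    have h1 : e * g = e := mem_leftFixingUnits.mp (htop ▸ Subgroup.mem_top g)
    rw [hg, mul_add, mul_one] at h1
    simpa using h1
  have hWy : W * y = y := by
    -- Move `W` past `T` by the inversion relation, then past `T y ∈ J` by centrality; cancelling
    -- `T` and `W` gives `W y = y`.
    have h1 : T * (W * W * y) = T * (W * y) := by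
      calc T * (W * W * y) = W * (T * y) := by rw [← mul_assoc, hTWW, mul_assoc]
        _ = T * y * W := hwJ _ ((Ring.jacobson R).mul_mem_left T hy)
        _ = T * (W * y) := by rw [mul_assoc, ← hwJ y hy]
    have h2 := t.isUnit.mul_right_injective h1
    rw [mul_assoc] at h2
    exact w.isUnit.mul_right_injective h2
  have h3 : e * y = y := by
    have : s * y = 3 * y := by
      rw [hs, add_mul, add_mul, mul_assoc, hWy, hWy]; noncomm_ring
    rw [he_def, mul_assoc, this, ← mul_assoc, hq3, one_mul]
  rw [Ideal.mem_bot, ← h3, hey]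

end TwoPower

/-! ### Orders of general linear groups -/

section Cardinality

variable {F : Type*} [Field F] [Finite F]

theorem card_GL_eq_prod (d : ℕ) :
    Nat.card (Matrix (Fin d) (Fin d) F)ˣ = ∏ i : Fin d, (Nat.card F ^ d - Nat.card F ^ (i : ℕ)) := by
  have := Fintype.ofFinite F
  rw [Nat.card_eq_fintype_card (α := F)]
  exact Matrix.card_GL_field d

theorem pow_sub_one_le_card_GL (d : ℕ) [NeZero d] :
    Nat.card F ^ d - 1 ≤ Nat.card (Matrix (Fin d) (Fin d) F)ˣ := by
  have hq : 1 < Nat.card F := Finite.one_lt_card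
  rw [card_GL_eq_prod]
  have h : ∀ i ∈ Finset.univ, 1 ≤ Nat.card F ^ d - Nat.card F ^ ((i : Fin d) : ℕ) := fun i _ ↦
    Nat.sub_pos_of_lt (Nat.pow_lt_pow_right hq i.2)
  simpa using Finset.single_le_prod' h (Finset.mem_univ (0 : Fin d))

/-- For `d = 2` the order is `(q² - 1)(q² - q)`, which is 6 at `q = 2` and at least 48 beyond; for
`d ≥ 3` the factor `q ^ d - 1` is already at least 7. -/
theorem six_le_card_GL {d : ℕ} (hd : 2 ≤ d) :
    6 ≤ Nat.card (Matrix (Fin d) (Fin d) F)ˣ ∧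
      (Nat.card (Matrix (Fin d) (Fin d) F)ˣ ≤ 6 → d = 2 ∧ Nat.card F = 2) := by
  have hq : 1 < Nat.card F := Finite.one_lt_card
  rcases hd.eq_or_lt with rfl | hd
  · rw [card_GL_eq_prod, Fin.prod_univ_two]
    simp only [Fin.val_zero, Fin.val_one, pow_zero, pow_one]
    rcases (show 2 ≤ Nat.card F from hq).eq_or_lt with h | h
    · rw [← h]; norm_num
    · have h1 : 8 ≤ Nat.card F ^ 2 - 1 := Nat.le_sub_of_add_le (by nlinarith)
      have h2 : 6 ≤ Nat.card F ^ 2 - Nat.card F := Nat.le_sub_of_add_le (by nlinarith)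
      have h3 := Nat.mul_le_mul h1 h2
      exact ⟨by omega, by omega⟩
  · have : NeZero d := ⟨by omega⟩
    have h1 := pow_sub_one_le_card_GL (F := F) d
    have h2 : 2 ^ 3 ≤ Nat.card F ^ d :=
      (Nat.pow_le_pow_left hq 3).trans (Nat.pow_le_pow_right (by omega) hd)
    exact ⟨by omega, by omega⟩

theorem eq_one_of_card_GL_eq_one {d : ℕ} [NeZero d]
    (h : Nat.card (Matrix (Fin d) (Fin d) F)ˣ = 1) : d = 1 ∧ Nat.card F = 2 := by
  have hq : 1 < Nat.card F := Finite.one_lt_card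
  have h1 := pow_sub_one_le_card_GL (F := F) d
  have hd : d ≠ 0 := NeZero.ne d
  have h2 : Nat.card F ≤ Nat.card F ^ d := Nat.le_self_pow hd _
  refine ⟨?_, by omega⟩
  by_contra hd1
  have h3 : Nat.card F ^ 2 ≤ Nat.card F ^ d := Nat.pow_le_pow_right (by omega) (by omega)
  nlinarith [show Nat.card F ^ d ≤ 2 by omega]

end Cardinality

/-! ### Semisimple rings with at most six units -/

section ProductDecomposition

theorem nonempty_ringEquiv_zmod_two {F : Type*} [Field F] (h : Nat.card F = 2) :
    Nonempty (F ≃+* ZMod 2) := by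
  have : Finite F := Nat.finite_of_card_ne_zero (by omega)
  have := Fintype.ofFinite F
  rw [Nat.card_eq_fintype_card] at h
  exact ⟨(ZMod.ringEquivOfPrime F Nat.prime_two h).symm⟩

/-- The large block uses up all six units, so every other block has a trivial unit group and must be
`GF(2)`. -/
theorem nonempty_ringEquiv_of_card_units_le_six {S : Type*} [Ring S] [Finite S] {n : ℕ}
    {D : Fin n → Type*} {d : Fin n → ℕ} [∀ i, DivisionRing (D i)] [∀ i, NeZero (d i)]
    (φ : S ≃+* Π i, Matrix (Fin (d i)) (Fin (d i)) (D i)) {i₀ : Fin n} (hi₀ : 2 ≤ d i₀)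
    (hcard : Nat.card Sˣ ≤ 6) :
    ∃ k : ℕ, Nonempty (S ≃+* Matrix (Fin 2) (Fin 2) (ZMod 2) × (Fin k → ZMod 2)) := by
  have hfin := finite_coefficients_of_pi_matrix φ
  have hprod : Nat.card Sˣ = ∏ i, Nat.card (Matrix (Fin (d i)) (Fin (d i)) (D i))ˣ := by
    rw [← Nat.card_pi]
    exact Nat.card_congr ((Units.mapEquiv φ.toMulEquiv).trans MulEquiv.piUnits).toEquiv
  rw [hprod, ← Finset.mul_prod_erase _ _ (Finset.mem_univ i₀)] at hcard
  obtain ⟨h6, h6'⟩ := six_le_card_GL (F := D i₀) hi₀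
  have hpos : ∀ i, 1 ≤ Nat.card (Matrix (Fin (d i)) (Fin (d i)) (D i))ˣ := fun i ↦ Nat.card_pos
  have hrest := Finset.one_le_prod' (s := Finset.univ.erase i₀) fun i _ ↦ hpos i
  have hi₀' := h6' (by nlinarith)
  have hother : ∀ i ≠ i₀, d i = 1 ∧ Nat.card (D i) = 2 := by
    intro i hi
    have h1 := Finset.single_le_prod' (f := fun i ↦ Nat.card (Matrix (Fin (d i)) (Fin (d i)) (D i))ˣ)
      (fun i _ ↦ hpos i) (Finset.mem_erase.mpr ⟨hi, Finset.mem_univ i⟩)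
    refine eq_one_of_card_GL_eq_one (F := D i) ?_
    have h2 := hpos i
    nlinarith
  have e₀ : Nonempty (Matrix (Fin (d i₀)) (Fin (d i₀)) (D i₀) ≃+*
      Matrix (Fin 2) (Fin 2) (ZMod 2)) := by
    obtain ⟨ψ⟩ := nonempty_ringEquiv_zmod_two (F := D i₀) hi₀'.2
    rw [hi₀'.1]
    exact ⟨ψ.mapMatrix⟩
  have e₁ : ∀ i : {i // ¬ i = i₀},
      Nonempty (Matrix (Fin (d i)) (Fin (d i)) (D i) ≃+* ZMod 2) := by
    intro i
    obtain ⟨h1, h2⟩ := hother i i.2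
    obtain ⟨ψ⟩ := nonempty_ringEquiv_zmod_two (F := D i) h2
    rw [h1]
    exact ⟨Matrix.uniqueRingEquiv.trans ψ⟩
  obtain ⟨e₀⟩ := e₀
  let E := Fintype.equivFin {i // ¬ i = i₀}
  refine ⟨_, ⟨φ.trans ((RingEquiv.piEquivPiSubtypeProd (fun i ↦ i = i₀) _).trans
    (RingEquiv.prodCongr ((RingEquiv.piUnique _).trans e₀)
      ((RingEquiv.piCongrRight fun i ↦ (e₁ i).some).trans
        (RingEquiv.piCongrLeft (fun _ ↦ ZMod 2) E))))⟩⟩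

end ProductDecomposition

/-! ### Assembly of the classification -/

theorem nonempty_ringEquiv_of_two_pow_card {R : Type*} [Ring R] [Finite R] {a : ℕ}
    (hcard : Nat.card R = 2 ^ a) (hR : IsMinimalNonNilpotent Rˣ)
    (hp : ∀ p : ℕ, p.Prime → ¬ IsPGroup p (R ⧸ Ring.jacobson R)ˣ) :
    ∃ k : ℕ, Nonempty (R ≃+* Matrix (Fin 2) (Fin 2) (ZMod 2) × (Fin k → ZMod 2)) := by
  have hnil : ¬ Group.IsNilpotent (R ⧸ Ring.jacobson R)ˣ := fun h ↦
    hR.1 (Group.isNilpotent_of_surjective_of_not_isPGroup _ unitsModJacobson_surjective hp hR.2)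
  have h2 : (2 : R ⧸ Ring.jacobson R) = 0 := by
    rw [← map_ofNat (Ideal.Quotient.mk (Ring.jacobson R)) 2, Ideal.Quotient.eq_zero_iff_mem]
    exact two_mem_jacobson (two_pow_eq_zero_of_card hcard)
  obtain ⟨n, D, d, _, _, ⟨φ⟩⟩ :=
    IsSemisimpleRing.exists_ringEquiv_pi_matrix_divisionRing (R ⧸ Ring.jacobson R)
  obtain ⟨i₀, hi₀⟩ := exists_two_le_of_not_isNilpotent_units φ hnil
  obtain ⟨x, y, hx0, hx, hy, hxyx, hyxy⟩ := exists_matrix_units_of_pi_matrix φ hi₀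
  obtain ⟨u, v, huv, hu, hv, hbraid⟩ := exists_braid_involutions h2 hx0 hx hy hxyx hyxy
  have hw3 := mul_pow_three_eq_one_of_braid hu hv hbraid
  have hconj := conj_mul_eq_inv_of_involutions hu hv
  have hw1 : u * v ≠ 1 := fun h ↦ huv (by
    rw [← mul_left_inj v, h, hv])
  have huH : u ∈ Subgroup.closure {u, v} := Subgroup.subset_closure (by simp)
  have hvH : v ∈ Subgroup.closure {u, v} := Subgroup.subset_closure (by simp)
  -- The preimage of a non-nilpotent subgroup is non-nilpotent, so minimality of `Rˣ` passes down to
  -- the quotient.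
  have htop : Subgroup.closure {u, v} = ⊤ := by
    have hH := Subgroup.not_isNilpotent_of_conj_eq_inv (mul_mem huH hvH) huH hw1
      (n := 3) (by decide) hw3 hconj
    have h1 := hR.eq_top_of_not_isNilpotent fun h ↦
      hH (Subgroup.isNilpotent_of_comap _ unitsModJacobson_surjective _ h)
    rw [eq_top_iff]
    intro q _
    obtain ⟨g, rfl⟩ := unitsModJacobson_surjective q
    exact Subgroup.mem_comap.mp (h1 ▸ Subgroup.mem_top g)
  obtain ⟨k, ⟨ψ⟩⟩ := nonempty_ringEquiv_of_card_units_le_six φ hi₀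
    (card_le_six_of_braid_involutions hu hv hbraid htop)
  have hJ := jacobson_eq_bot_of_conj_eq_inv hcard hR hw3 hw1 hconj
  have hbij : Function.Bijective (Ideal.Quotient.mk (Ring.jacobson R)) := by
    refine ⟨(injective_iff_map_eq_zero _).mpr fun r hr ↦ ?_, Ideal.Quotient.mk_surjective⟩
    rwa [Ideal.Quotient.eq_zero_iff_mem, hJ, Ideal.mem_bot] at hr
  exact ⟨k, ⟨(RingEquiv.ofBijective _ hbij).trans ψ⟩⟩

theorem theorem1 {R : Type*} [Ring R] [Finite R] (a m : ℕ) (hm : Odd m)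
    (hcard : Nat.card R = 2 ^ a * m) (hR : IsMinimalNonNilpotent Rˣ) :
    Nat.card R = 2 ^ a ∧
      ((∀ p : ℕ, p.Prime → ¬ IsPGroup p (R ⧸ Ring.jacobson R)ˣ) →
        Nonempty (R ≃+* Matrix (Fin 2) (Fin 2) (ZMod 2)) ∨
        ∃ k : ℕ, 0 < k ∧
          Nonempty (R ≃+* Matrix (Fin 2) (Fin 2) (ZMod 2) × (Fin k → ZMod 2))) := by
  obtain rfl := odd_part_eq_one_of_isMinimalNonNilpotent_units hm hcard hR
  rw [mul_one] at hcard
  refine ⟨hcard, fun hp ↦ ?_⟩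
  obtain ⟨k, ⟨ψ⟩⟩ := nonempty_ringEquiv_of_two_pow_card hcard hR hp
  rcases Nat.eq_zero_or_pos k with rfl | hk
  · refine Or.inl ⟨ψ.trans (RingEquiv.ofBijective (RingHom.fst _ _) ⟨fun x y h ↦ ?_, fun x ↦ ?_⟩)⟩
    · exact Prod.ext h (Subsingleton.elim _ _)
    · exact ⟨(x, 0), rfl⟩
  · exact Or.inr ⟨k, hk, ⟨ψ⟩⟩
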